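/- **Conventions.** All structures are finite and relational, with nonempty universe and finite vocabulary. For a class $\mathcal K$ of structures over a vocabulary $\{R_1,\dots,R_m\}$ that is closed under isomorphism, the generalized quantifier $Q_{\mathcal K}$ binds tuples $\bar y_1,\dots,\bar y_m$ of distinct variables, $|\bar y_i|=\mathrm{ar}(R_i)$, in formulas $\psi_1,\dots,\psi_m$; $(\mathbf A,\alpha)\models Q_{\mathcal K}\bar y_1,\dots,\bar y_m(\psi_1,\dots,\psi_m)$ iff the structure with universe $A$ and relations $\{\bar b \mid (\mathbf A,\alpha[\bar b/\bar y_i])\models\psi_i\}$ is in $\mathcal K$. Its arity is $\max_i \mathrm{ar}(R_i)$. $\mathcal Q_k$ is the collection of all quantifiers of arity at most $k$. The partial Maltsev operation on a set $A$ is the partial function $m\colon A^3\to A$ with $m(a,a,b)=m(b,a,a)=b$, and $m(a,b,c)$ undefined if $a\ne b$ and $b\ne c$; for $R\subseteq A^r$ let $m(R)$ be the set of results of applying $m$ componentwise to three tuples of $R$. $Q_{\mathcal K}$ is Maltsev-closed if $\mathbf A\in\mathcal K$ whenever $\mathbf B\in\mathcal K$, $A=B$ and $R^{\mathbf A}\subseteq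 R^{\mathbf B}\cup m(R^{\mathbf B})$ for every relation symbol $R$. $\mathcal Q_k^{\mathcal M}$ is the collection of all Maltsev-closed quantifiers in $\mathcal Q_k$. $\mathcal L^k(\mathcal Q)$ is the infinitary logic with $k$ variables (and equality), extended by the quantifiers in $\mathcal Q$. $L\le L'$ means that every sentence of $L$ is equivalent on all structures to a sentence of $L'$, and $L\lneq L'$ means $L\le L'$ and $L'\not\le L$. **The structures.** Let $G=(V,E)$ be a finite $k$-regular graph with at least one edge and with a linear order on $V$; order $E$ lexicographically, comparing first the smaller and then the larger endpoints. For $v\in V$ let $e_1<\dots<e_k$ be the edges at $v$ and, for $s\in\{0,1\}$, put $$R_0(v,s)=\Big\{((e_1,a_1),\dots,(e_k,a_k)) \;\Big|\; a_i\in\mathbb Z_4,\ \sum_i a_i-2s\in\{0,1\}\Big\},\qquad R_1(v,s)=\Big\{((e_1,a_1),\dots,(e_k,a_k)) \;\Big|\; a_i\in\mathbb Z_4,\ \sum_i a_i-2s\in\{2,3\}\Big\}.$$ $\mathbf A(G)$ has universe $E\times\mathbb Z_4$, the $k$-ary relations $R_j=\bigcup_{v\in V}R_j(v,0)$ for $j=0,1$,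 and the binary relation $(e,a)\prec(e',a')\iff e\le e'$. $\tilde{\mathbf A}(G)$ is defined in the same way, except that $R_j(\tilde v,1)$ replaces $R_j(\tilde v,0)$ for the smallest vertex $\tilde v$ of $G$. **The $k$-variable Maltsev game** on $\mathbf A,\mathbf B$. A position is a pair $(\alpha,\beta)$ of partial assignments of elements of $\mathbf A$, respectively $\mathbf B$, to variables $x_1,\dots,x_k$ with the same domain. If $\alpha\mapsto\beta$ is not a partial isomorphism, Spoiler wins. Otherwise Spoiler chooses a left or a right move, $r\in\{1,\dots,k\}$ and an $r$-tuple $\bar y$ of distinct variables. In a right move, Duplicator chooses a bijection $f\colon A\to B$, Spoiler chooses $\bar a\in A^r$, Duplicator chooses $P=\{\bar b_1,\bar b_2,\bar b_3\}\subseteq B^r$ with $f(\bar a)$ in the closure of $P$ under $m$, Spoiler chooses $\bar b\in P$, and the next position is $(\alpha[\bar a/\bar y],\beta[\bar b/\bar y])$. A left move is the same with the roles of $\mathbf A$ and $\mathbf B$ exchanged. Duplicator wins if Spoiler does not win after finitely many rounds. **Theorem.** For every $k\ge 3$, $$\mathcal L^k(\mathcal Q_k^{\mathcal M})\lneq\mathcal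 L^k(\mathcal Q_k).$$ Moreover, let $G$ be the graph obtained from the complete bipartite graph $K_{k+1,k+1}$ by removing a perfect matching, with any linear order on its vertices. Then $\mathbf A(G)$ and $\tilde{\mathbf A}(G)$ are not isomorphic; some sentence of $\mathcal L^k(\mathcal Q_k)$ is true in $\mathbf A(G)$ and false in $\tilde{\mathbf A}(G)$; $\mathbf A(G)$ and $\tilde{\mathbf A}(G)$ satisfy the same sentences of $\mathcal L^k(\mathcal Q_k^{\mathcal M})$; and Duplicator has a winning strategy in the $k$-variable Maltsev game on $\mathbf A(G)$ and $\tilde{\mathbf A}(G)$ from the empty position. -/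

import Mathlib

/-! Finite relational vocabularies and structures -/

/-- A finite relational vocabulary `{R_0, …, R_{m-1}}` with the arities of its symbols. -/
structure Vocabulary where
  m : ℕ
  ar : Fin m → ℕ

/-- A finite relational structure over `σ` (with nonempty universe). -/
structure FinStr (σ : Vocabulary) where
  carrier : Type
  finite : Finite carrier
  nonempty : Nonempty carrier
  rel : ∀ i : Fin σ.m, Set (Fin (σ.ar i) → carrier)

/-- The structure with the same universe as `A` and with the relations `R`
(possibly over another vocabulary). -/
def FinStr.withRel {σ τ : Vocabulary} (A : FinStr σ)
    (R : ∀ i : Fin τ.m, Set (Fin (τ.ar i) → A.carrier)) : FinStr τ where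
  carrier := A.carrier
  finite := A.finite
  nonempty := A.nonempty
  rel := R

/-- `A` and `B` are isomorphic. -/
def FinStr.Isomorphic {σ : Vocabulary} (A B : FinStr σ) : Prop :=
  ∃ f : A.carrier ≃ B.carrier,
    ∀ (i : Fin σ.m) (t : Fin (σ.ar i) → A.carrier), t ∈ A.rel i ↔ (fun j => f (t j)) ∈ B.rel i

/-! Generalized quantifiers -/

/-- A generalized (Lindström) quantifier `Q_K`: an isomorphism-closed class `K` of finite
structures over a finite relational vocabulary. -/
structure Quantifier where
  voc : Vocabulary
  cls : Set (FinStr voc)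
  iso_closed : ∀ A B : FinStr voc, A.Isomorphic B → A ∈ cls → B ∈ cls

/-- The collection of all quantifiers of arity at most `r`. -/
def quantifiersOfArity (r : ℕ) : Set Quantifier :=
  {Q | ∀ i : Fin Q.voc.m, Q.voc.ar i ≤ r}

/-- The graph of the partial Maltsev operation: `IsMaltsev a b c d` says that `m(a, b, c)` is
defined and equal to `d`. Thus `m(a, a, c) = c` and `m(a, b, b) = a`, and `m(a, b, c)` is
undefined if `a ≠ b` and `b ≠ c`. -/
def IsMaltsev {A : Type} (a b c d : A) : Prop :=
  (a = b ∧ d = c) ∨ (b = c ∧ d = a)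

theorem IsMaltsev.unique {A : Type} {a b c d d' : A}
    (h : IsMaltsev a b c d) (h' : IsMaltsev a b c d') : d = d' := by
  unfold IsMaltsev at h h'
  grind

/-- `m(R)`: all results of applying the partial Maltsev operation columnwise to three tuples
of `R`. -/
def maltsevImage {A : Type} {r : ℕ} (R : Set (Fin r → A)) : Set (Fin r → A) :=
  {d | ∃ a ∈ R, ∃ b ∈ R, ∃ c ∈ R, ∀ j, IsMaltsev (a j) (b j) (c j) (d j)}

/-- `Q_K` is closed under the partial Maltsev operation: `B ∈ K` and `A ≤ B ∪ m(B)` imply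
`A ∈ K`. -/
def Quantifier.MaltsevClosed (Q : Quantifier) : Prop :=
  ∀ B ∈ Q.cls, ∀ R : ∀ i : Fin Q.voc.m, Set (Fin (Q.voc.ar i) → B.carrier),
    (∀ i, R i ⊆ B.rel i ∪ maltsevImage (B.rel i)) → B.withRel R ∈ Q.cls

/-- The collection of all Maltsev-closed quantifiers of arity at most `r`. -/
def maltsevQuantifiersOfArity (r : ℕ) : Set Quantifier :=
  {Q | Q.MaltsevClosed} ∩ quantifiersOfArity r

/-! Infinitary `k`-variable logic with generalized quantifiers -/

/-- Formulas over `σ` of the infinitary `k`-variable logic extended by the quantifiers in `𝒬`.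
The variables are the elements of `Fin k`; disjunction and `∀` are expressed with negation. -/
inductive Formula (σ : Vocabulary) (k : ℕ) (𝒬 : Set Quantifier) : Type 1
  | eq (x y : Fin k) : Formula σ k 𝒬
  | rel (i : Fin σ.m) (x : Fin (σ.ar i) → Fin k) : Formula σ k 𝒬
  | neg (φ : Formula σ k 𝒬) : Formula σ k 𝒬
  | conj {ι : Type} (φ : ι → Formula σ k 𝒬) : Formula σ k 𝒬
  | ex (x : Fin k) (φ : Formula σ k 𝒬) : Formula σ k 𝒬
  | quant (Q : Quantifier) (hQ : Q ∈ 𝒬) (y : ∀ i : Fin Q.voc.m, Fin (Q.voc.ar i) ↪ Fin k)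
      (ψ : Fin Q.voc.m → Formula σ k 𝒬) : Formula σ k 𝒬

namespace Formula

variable {σ : Vocabulary} {k : ℕ} {𝒬 : Set Quantifier}

/-- The free variables of a formula. -/
def freeVars : Formula σ k 𝒬 → Set (Fin k)
  | eq x y => {x, y}
  | rel _ x => Set.range x
  | neg φ => φ.freeVars
  | conj φ => ⋃ i, (φ i).freeVars
  | ex x φ => φ.freeVars \ {x}
  | quant _ _ y ψ => ⋃ i, (ψ i).freeVars \ Set.range (y i)

/-- Satisfaction. Here `Function.extend y b α` is the assignment `α[b/y]`. -/
def Sat (A : FinStr σ) : Formula σ k 𝒬 → (Fin k → A.carrier) → Prop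
  | eq x y, α => α x = α y
  | rel i x, α => (fun j => α (x j)) ∈ A.rel i
  | neg φ, α => ¬ φ.Sat A α
  | conj φ, α => ∀ i, (φ i).Sat A α
  | ex x φ, α => ∃ a : A.carrier, φ.Sat A (Function.update α x a)
  | quant Q _ y ψ, α =>
      A.withRel (fun i => {b | (ψ i).Sat A (Function.extend (y i) b α)}) ∈ Q.cls

end Formula

/-- Sentences: formulas without free variables. -/
def Sentence (σ : Vocabulary) (k : ℕ) (𝒬 : Set Quantifier) : Type 1 :=
  {φ : Formula σ k 𝒬 // φ.freeVars = ∅}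

/-- Truth of a sentence in a structure (its truth value does not depend on the assignment). -/
def FinStr.Models {σ : Vocabulary} {k : ℕ} {𝒬 : Set Quantifier} (A : FinStr σ)
    (φ : Sentence σ k 𝒬) : Prop :=
  ∀ α : Fin k → A.carrier, φ.1.Sat A α

/-- `L^k(𝒬) ≤ L^k(𝒬')`: every sentence of the first logic is equivalent, on all finite
structures, to a sentence of the second. -/
def LogicLE (k : ℕ) (𝒬 𝒬' : Set Quantifier) : Prop :=
  ∀ (σ : Vocabulary) (φ : Sentence σ k 𝒬), ∃ φ' : Sentence σ k 𝒬',
    ∀ A : FinStr σ, A.Models φ ↔ A.Models φ'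

/-- `L^k(𝒬)` is strictly weaker than `L^k(𝒬')`. -/
def LogicLT (k : ℕ) (𝒬 𝒬' : Set Quantifier) : Prop :=
  LogicLE k 𝒬 𝒬' ∧ ¬ LogicLE k 𝒬' 𝒬

/-! The pebble game for Maltsev-closed quantifiers -/

/-- The closure of a set of tuples under the partial Maltsev operation. -/
inductive MaltsevClosure {A : Type} {r : ℕ} (P : Set (Fin r → A)) : Set (Fin r → A)
  | base {a : Fin r → A} (ha : a ∈ P) : MaltsevClosure P a
  | step {a b c d : Fin r → A} (ha : MaltsevClosure P a) (hb : MaltsevClosure P b)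
      (hc : MaltsevClosure P c) (h : ∀ j, IsMaltsev (a j) (b j) (c j) (d j)) : MaltsevClosure P d

/-- Partial assignments of elements of `A` to the `k` variables. -/
abbrev PartialAssignment (k : ℕ) {σ : Vocabulary} (A : FinStr σ) : Type :=
  Fin k → Option A.carrier

/-- `α ↦ β` is a partial isomorphism from `A` to `B`: the domains agree, and equalities and
relations between pebbled elements are preserved in both directions. -/
def IsPartialIso {k : ℕ} {σ : Vocabulary} (A B : FinStr σ)
    (α : PartialAssignment k A) (β : PartialAssignment k B) : Prop :=
  (∀ x, α x = none ↔ β x = none) ∧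
  (∀ x y, α x = α y ↔ β x = β y) ∧
  ∀ (i : Fin σ.m) (x : Fin (σ.ar i) → Fin k)
    (a : Fin (σ.ar i) → A.carrier) (b : Fin (σ.ar i) → B.carrier),
    (∀ j, α (x j) = some (a j)) → (∀ j, β (x j) = some (b j)) → (a ∈ A.rel i ↔ b ∈ B.rel i)

/-- The assignment `α[a/y]`. -/
noncomputable def PartialAssignment.subst {k : ℕ} {σ : Vocabulary} {A : FinStr σ} {r : ℕ}
    (α : PartialAssignment k A) (y : Fin r ↪ Fin k) (a : Fin r → A.carrier) :
    PartialAssignment k A :=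
  Function.extend y (fun j => some (a j)) α

/-- From the position `(α, β)`, whatever left quantifier move Spoiler makes, Duplicator can
answer so that the next position is in `W`. -/
def LeftMove {k : ℕ} {σ : Vocabulary} (A B : FinStr σ)
    (W : PartialAssignment k A → PartialAssignment k B → Prop)
    (α : PartialAssignment k A) (β : PartialAssignment k B) : Prop :=
  ∀ r : ℕ, 1 ≤ r → r ≤ k → ∀ y : Fin r ↪ Fin k,
    ∃ f : B.carrier ≃ A.carrier, ∀ b : Fin r → B.carrier,
      ∃ p : Fin 3 → Fin r → A.carrier,
        (fun j => f (b j)) ∈ MaltsevClosure (Set.range p) ∧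
        ∀ a ∈ Set.range p, W (α.subst y a) (β.subst y b)

/-- The same for right quantifier moves. -/
def RightMove {k : ℕ} {σ : Vocabulary} (A B : FinStr σ)
    (W : PartialAssignment k A → PartialAssignment k B → Prop)
    (α : PartialAssignment k A) (β : PartialAssignment k B) : Prop :=
  ∀ r : ℕ, 1 ≤ r → r ≤ k → ∀ y : Fin r ↪ Fin k,
    ∃ f : A.carrier ≃ B.carrier, ∀ a : Fin r → A.carrier,
      ∃ p : Fin 3 → Fin r → B.carrier,
        (fun j => f (a j)) ∈ MaltsevClosure (Set.range p) ∧
        ∀ b ∈ Set.range p, W (α.subst y a) (β.subst y b)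

/-- Duplicator has a winning strategy in the `k`-variable Maltsev game on `A` and `B` from the
position `(α, β)`: there is a set `W` of positions containing `(α, β)`, in none of which Spoiler
has won, such that Duplicator can always move from `W` to `W`. -/
def DuplicatorWins (k : ℕ) {σ : Vocabulary} (A B : FinStr σ)
    (α : PartialAssignment k A) (β : PartialAssignment k B) : Prop :=
  ∃ W : PartialAssignment k A → PartialAssignment k B → Prop, W α β ∧
    ∀ α' β', W α' β' → IsPartialIso A B α' β' ∧ LeftMove A B W α' β' ∧ RightMove A B W α' β'

/-! The CFI-like structures over `ZMod 4` -/

/-- Two symbols `R₀`, `R₁` of arity `k` and a binary symbol `≺`. -/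
abbrev cfiVocabulary (k : ℕ) : Vocabulary where
  m := 3
  ar := ![k, k, 2]

/-- The endpoints of an edge in increasing order; comparing these pairs is the lexicographic
order on edges induced by the order of the vertices. -/
def edgeKey {V : Type} [LinearOrder V] {G : SimpleGraph V} (e : G.edgeSet) : V ×ₗ V :=
  toLex ((e : Sym2 V).inf, (e : Sym2 V).sup)

/-- The relation `R_j` of the gadget of the vertex `v` with charge `s`: the tuples
`((e_1, a_1), …, (e_k, a_k))`, with `e_1 < … < e_k` the edges at `v`, such that
`a_1 + … + a_k - 2 s` lies in `{0, 1}` (for `j = 0`) or in `{2, 3}` (for `j = 1`). -/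
def gadgetRel {V : Type} [LinearOrder V] (G : SimpleGraph V) (k : ℕ) (v : V) (s : ZMod 4)
    (j : Fin 2) : Set (Fin k → G.edgeSet × ZMod 4) :=
  {t | StrictMono (fun i => edgeKey (t i).1) ∧
    Set.range (fun i => ((t i).1 : Sym2 V)) = G.incidenceSet v ∧
    (∑ i, (t i).2) - 2 * s ∈ (![{0, 1}, {2, 3}] : Fin 2 → Set (ZMod 4)) j}

/-- The relation `R_j` of the whole structure: the union over all vertices of the gadget relations,
where exactly the vertices in `U` have charge `1`. -/
def cfiRel {V : Type} [LinearOrder V] (G : SimpleGraph V) (k : ℕ) (U : Set V) (j : Fin 2) :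
    Set (Fin k → G.edgeSet × ZMod 4) :=
  (⋃ v ∈ Uᶜ, gadgetRel G k v 0 j) ∪ ⋃ v ∈ U, gadgetRel G k v 1 j

/-- The preorder `≺`: `(e, a) ≺ (e', a')` if and only if `e ≤ e'`. -/
def cfiPreorder {V : Type} [LinearOrder V] (G : SimpleGraph V) :
    Set (Fin 2 → G.edgeSet × ZMod 4) :=
  {t | edgeKey (t 0).1 ≤ edgeKey (t 1).1}

/-- The CFI-like structure over the ordered `k`-regular graph `G` in which exactly the vertices
in `U` have charge `1`. -/
def cfi {V : Type} [Fintype V] [LinearOrder V] (G : SimpleGraph V) [Nonempty G.edgeSet] (k : ℕ)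
    (U : Set V) : FinStr (cfiVocabulary k) where
  carrier := G.edgeSet × ZMod 4
  finite := inferInstance
  nonempty := inferInstance
  rel := fun (i : Fin 3) => match i with
    | 0 => cfiRel G k U 0
    | 1 => cfiRel G k U 1
    | 2 => cfiPreorder G

/-- The untwisted structure. -/
def cfiUntwisted {V : Type} [Fintype V] [LinearOrder V] (G : SimpleGraph V)
    [Nonempty G.edgeSet] (k : ℕ) : FinStr (cfiVocabulary k) :=
  cfi G k ∅

/-- The twisted structure: only the smallest vertex has charge `1`. -/
def cfiTwisted {V : Type} [Fintype V] [LinearOrder V] (G : SimpleGraph V)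
    [Nonempty G.edgeSet] (k : ℕ) : FinStr (cfiVocabulary k) :=
  cfi G k {v | ∀ u, v ≤ u}

/-- The complete bipartite graph `K_{n,n}` minus a perfect matching. -/
def bicliqueMinusMatching (n : ℕ) : SimpleGraph (Fin n ⊕ Fin n) :=
  (completeBipartiteGraph (Fin n) (Fin n)).deleteEdges
    (Set.range fun i => s(Sum.inl i, Sum.inr i))

/-!
Duplicator matches the pebbles by a fibrewise affine map `(e, a) ↦ (e, ε * a + c e)` with
`ε = ±1`. Such a map preserves the gadget of a vertex if the shifts `c e` of the edges at this
vertex add up to the right value. Duplicator needs this at all vertices but one, as long as some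
edge at the exceptional vertex carries no pebble. As there are `k` pebbles and every vertex has
`k ≥ 3` edges, shifting a pebble-free edge moves the exceptional vertex, if necessary, to a vertex
`v` with two free edges `d` and `e`.

If Spoiler then pebbles all edges at `v`, Duplicator shifts the fibre of `d`, those of both `d` and
`e`, or that of `e` by the same amount, chosen so that each of the three answers puts the sum at
`v` into the correct one of the classes `{0, 1}` and `{2, 3}`; the Maltsev operation cancels these
shifts. Once the class is correct, some sign `ε'` and new shifts realize the pebbles and preserve
the gadget of `v`, and since the graph without `v` is connected, the remaining shifts can be chosen
so that only one vertex other than `v` is exceptional.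

An isomorphism preserves each fibre, and its differences from `(e, 0)` to `(e, 1)` are `1` on all
edges at a vertex or `-1` on all of them. Counting these signs, and then the values at `0`, over
either side of a bipartition of a regular graph shows that the two sides have the same number of
twisted vertices modulo `2`, so that a single twist cannot be undone.
-/

section Logic

variable {k : ℕ} {σ : Vocabulary} {A B : FinStr σ} {𝒬 𝒬' : Set Quantifier}
  {W : PartialAssignment k A → PartialAssignment k B → Prop}
  {α : PartialAssignment k A} {β : PartialAssignment k B}

theorem MaltsevClosure.mono {A : Type} {r : ℕ} {P R : Set (Fin r → A)} (h : P ⊆ R) :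
    MaltsevClosure P ⊆ MaltsevClosure R := by
  intro a ha
  induction ha with
  | base ha => exact MaltsevClosure.base (h ha)
  | step _ _ _ h iha ihb ihc => exact MaltsevClosure.step iha ihb ihc h

theorem Quantifier.MaltsevClosed.mem_of_subset_closure {Q : Quantifier} (hQ : Q.MaltsevClosed)
    {B : FinStr Q.voc} (hB : B ∈ Q.cls) {R : ∀ i : Fin Q.voc.m, Set (Fin (Q.voc.ar i) → B.carrier)}
    (hR : ∀ i, R i ⊆ MaltsevClosure (B.rel i)) : B.withRel R ∈ Q.cls := by
  have := B.finite
  let 𝒮 : Set (∀ i : Fin Q.voc.m, Set (Fin (Q.voc.ar i) → B.carrier)) :=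
    {S | B.withRel S ∈ Q.cls ∧ B.rel ≤ S}
  obtain ⟨S, ⟨hS, hBS⟩, hmax⟩ := (Set.toFinite 𝒮).exists_maximal ⟨B.rel, hB, le_rfl⟩
  have hstep : (fun i => S i ∪ maltsevImage (S i)) ∈ 𝒮 :=
    ⟨hQ _ hS _ fun _ => subset_rfl, fun i => (hBS i).trans Set.subset_union_left⟩
  have hfix (i) : maltsevImage (S i) ⊆ S i :=
    Set.subset_union_right.trans (hmax hstep (fun _ => Set.subset_union_left) i)
  have hcl (i) : MaltsevClosure (B.rel i) ⊆ S i := by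
    intro a ha
    induction ha with
    | base ha => exact hBS i ha
    | step _ _ _ h iha ihb ihc => exact hfix i ⟨_, iha, _, ihb, _, ihc, h⟩
  exact hQ _ hS R fun i => ((hR i).trans (hcl i)).trans Set.subset_union_left

/-- A right move in which Duplicator chooses the bijection before Spoiler chooses the variables. -/
def UniformMove (A B : FinStr σ) (W : PartialAssignment k A → PartialAssignment k B → Prop)
    (α : PartialAssignment k A) (β : PartialAssignment k B) : Prop :=
  ∃ f : A.carrier ≃ B.carrier, ∀ (r : ℕ) (y : Fin r ↪ Fin k) (a : Fin r → A.carrier),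
    ∃ p : Fin 3 → Fin r → B.carrier,
      f ∘ a ∈ MaltsevClosure (Set.range p) ∧ ∀ b ∈ Set.range p, W (α.subst y a) (β.subst y b)

/-- A set of positions in which Duplicator can stay forever, even if the moves are uniform. This
suffices for the logic too, where one quantifier may bind tuples of several different lengths. -/
def IsUniformStrategy (A B : FinStr σ)
    (W : PartialAssignment k A → PartialAssignment k B → Prop) : Prop :=
  ∀ α β, W α β →
    IsPartialIso A B α β ∧ UniformMove A B W α β ∧ UniformMove B A (flip W) β α

theorem IsUniformStrategy.duplicatorWins (hW : IsUniformStrategy A B W) (h : W α β) :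
    DuplicatorWins k A B α β := by
  refine ⟨W, h, fun α β hαβ => ?_⟩
  obtain ⟨hiso, ⟨f, hf⟩, g, hg⟩ := hW α β hαβ
  exact ⟨hiso, fun r _ _ y => ⟨g, hg r y⟩, fun r _ _ y => ⟨f, hf r y⟩⟩

theorem UniformMove.exists_subst (h : UniformMove A B W α β) {r : ℕ} (y : Fin r ↪ Fin k)
    (a : Fin r → A.carrier) : ∃ b, W (α.subst y a) (β.subst y b) := by
  obtain ⟨f, hf⟩ := h
  obtain ⟨p, -, hp⟩ := hf r y a
  exact ⟨p 0, hp _ ⟨0, rfl⟩⟩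

theorem UniformMove.withRel_mem {Q : Quantifier} (hQ : Q.MaltsevClosed)
    (h : UniformMove A B W α β) (y : ∀ i : Fin Q.voc.m, Fin (Q.voc.ar i) ↪ Fin k)
    {R : ∀ i : Fin Q.voc.m, Set (Fin (Q.voc.ar i) → A.carrier)}
    {S : ∀ i : Fin Q.voc.m, Set (Fin (Q.voc.ar i) → B.carrier)}
    (hRS : ∀ i a b, W (α.subst (y i) a) (β.subst (y i) b) → (a ∈ R i ↔ b ∈ S i))
    (hS : B.withRel S ∈ Q.cls) : A.withRel R ∈ Q.cls := by
  obtain ⟨f, hf⟩ := h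
  have hfR : B.withRel (fun i => {b | f.symm ∘ b ∈ R i}) ∈ Q.cls := by
    refine hQ.mem_of_subset_closure hS fun i (b : Fin _ → B.carrier) hb => ?_
    obtain ⟨p, hp, hpW⟩ := hf _ (y i) (f.symm ∘ b)
    rw [← Function.comp_assoc, f.self_comp_symm, Function.id_comp] at hp
    exact MaltsevClosure.mono (fun c hc => (hRS i _ c (hpW c hc)).1 hb) hp
  exact Q.iso_closed _ _ ⟨f.symm, fun _ _ => Iff.rfl⟩ hfR

theorem PartialAssignment.subst_eq_some {α' : Fin k → A.carrier} {S : Set (Fin k)} {r : ℕ}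
    (y : Fin r ↪ Fin k) (a : Fin r → A.carrier)
    (h : ∀ x ∈ S \ Set.range y, α x = some (α' x)) :
    ∀ x ∈ S, α.subst y a x = some (Function.extend y a α' x) := by
  intro x hx
  rw [PartialAssignment.subst]
  by_cases hy : x ∈ Set.range y
  · obtain ⟨j, rfl⟩ := hy
    rw [y.injective.extend_apply, y.injective.extend_apply]
  · rw [Function.extend_apply' _ _ _ hy, Function.extend_apply' _ _ _ hy]
    exact h x ⟨hx, hy⟩

theorem extend_eq_update {ι κ C : Type*} [Unique ι] [DecidableEq κ] (y : ι → κ) (c : ι → C)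
    (γ : κ → C) : Function.extend y c γ = Function.update γ (y default) (c default) := by
  have hy : Function.Injective y := Function.injective_of_subsingleton y
  ext z
  by_cases hz : z = y default
  · rw [hz, hy.extend_apply, Function.update_self]
  · rw [Function.update_of_ne hz, Function.extend_apply']
    rintro ⟨i, rfl⟩
    exact hz (congrArg y (Subsingleton.elim _ _))

theorem IsUniformStrategy.sat_iff (h𝒬 : ∀ Q ∈ 𝒬, Q.MaltsevClosed) (hW : IsUniformStrategy A B W)
    (φ : Formula σ k 𝒬) {α : PartialAssignment k A} {β : PartialAssignment k B}
    {α' : Fin k → A.carrier} {β' : Fin k → B.carrier} (h : W α β)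
    (hα : ∀ x ∈ φ.freeVars, α x = some (α' x)) (hβ : ∀ x ∈ φ.freeVars, β x = some (β' x)) :
    φ.Sat A α' ↔ φ.Sat B β' := by
  obtain ⟨hiso, hright, hleft⟩ := hW _ _ h
  induction φ generalizing α β α' β' with
  | eq x y =>
    have hxy := hiso.2.1 x y
    rw [hα x (.inl rfl), hα y (.inr rfl), hβ x (.inl rfl), hβ y (.inr rfl)] at hxy
    simpa only [Formula.Sat, Option.some.injEq] using hxy
  | rel i x => exact hiso.2.2 i x _ _ (fun j => hα _ ⟨j, rfl⟩) fun j => hβ _ ⟨j, rfl⟩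
  | neg φ ih => exact not_congr (ih h hα hβ hiso hright hleft)
  | conj φ ih =>
    exact forall_congr' fun i => ih i h (fun x hx => hα x (Set.mem_iUnion_of_mem i hx))
      (fun x hx => hβ x (Set.mem_iUnion_of_mem i hx)) hiso hright hleft
  | ex x φ ih =>
    let y : Fin 1 ↪ Fin k := ⟨fun _ => x, Function.injective_of_subsingleton _⟩
    have hy : (Formula.ex x φ).freeVars = φ.freeVars \ Set.range y :=
      congrArg _ Set.range_const.symm
    have transfer (a b) (hab : W (α.subst y a) (β.subst y b)) :
        φ.Sat A (Function.update α' x (a 0)) ↔ φ.Sat B (Function.update β' x (b 0)) := by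
      obtain ⟨hiso, hright, hleft⟩ := hW _ _ hab
      have := ih hab (PartialAssignment.subst_eq_some y a (hy ▸ hα))
        (PartialAssignment.subst_eq_some y b (hy ▸ hβ)) hiso hright hleft
      rwa [extend_eq_update, extend_eq_update] at this
    constructor
    · rintro ⟨a, ha⟩
      obtain ⟨b, hab⟩ := hright.exists_subst y fun _ => a
      exact ⟨b 0, (transfer _ b hab).1 ha⟩
    · rintro ⟨b, hb⟩
      obtain ⟨a, hab⟩ := hleft.exists_subst y fun _ => b
      exact ⟨a 0, (transfer a _ hab).2 hb⟩
  | quant Q hQ y ψ ih =>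
    have transfer (i a b) (hab : W (α.subst (y i) a) (β.subst (y i) b)) :
        (ψ i).Sat A (Function.extend (y i) a α') ↔ (ψ i).Sat B (Function.extend (y i) b β') := by
      obtain ⟨hiso, hright, hleft⟩ := hW _ _ hab
      exact ih i hab
        (PartialAssignment.subst_eq_some (y i) a fun x hx => hα x (Set.mem_iUnion_of_mem i hx))
        (PartialAssignment.subst_eq_some (y i) b fun x hx => hβ x (Set.mem_iUnion_of_mem i hx))
        hiso hright hleft
    exact ⟨hleft.withRel_mem (h𝒬 Q hQ) y fun i a b hab => (transfer i b a hab).symm,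
      hright.withRel_mem (h𝒬 Q hQ) y transfer⟩

theorem IsUniformStrategy.models_iff (h𝒬 : ∀ Q ∈ 𝒬, Q.MaltsevClosed)
    (hW : IsUniformStrategy A B W) (h : W (fun _ => none) (fun _ => none)) (φ : Sentence σ k 𝒬) :
    A.Models φ ↔ B.Models φ := by
  have hsat (α' β') : φ.1.Sat A α' ↔ φ.1.Sat B β' :=
    hW.sat_iff h𝒬 φ.1 h (by simp only [φ.2, Set.mem_empty_iff_false, false_imp_iff, implies_true])
      (by simp only [φ.2, Set.mem_empty_iff_false, false_imp_iff, implies_true])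
  obtain ⟨a⟩ := A.nonempty
  obtain ⟨b⟩ := B.nonempty
  exact ⟨fun hA β => (hsat (fun _ => a) β).1 (hA _), fun hB α => (hsat α fun _ => b).2 (hB _)⟩

/-- The formula itself, over a larger collection of quantifiers. -/
def Formula.lift (h : 𝒬 ⊆ 𝒬') : Formula σ k 𝒬 → Formula σ k 𝒬'
  | eq x y => eq x y
  | rel i x => rel i x
  | neg φ => neg (φ.lift h)
  | conj φ => conj fun i => (φ i).lift h
  | ex x φ => ex x (φ.lift h)
  | quant Q hQ y ψ => quant Q (h hQ) y fun i => (ψ i).lift h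

theorem Formula.freeVars_lift (h : 𝒬 ⊆ 𝒬') (φ : Formula σ k 𝒬) :
    (φ.lift h).freeVars = φ.freeVars := by
  induction φ <;> simp_all [Formula.lift, Formula.freeVars]

theorem Formula.sat_lift (h : 𝒬 ⊆ 𝒬') (φ : Formula σ k 𝒬) (α : Fin k → A.carrier) :
    (φ.lift h).Sat A α ↔ φ.Sat A α := by
  induction φ generalizing α <;> simp_all [Formula.lift, Formula.Sat]

theorem LogicLE.of_subset (h : 𝒬 ⊆ 𝒬') : LogicLE k 𝒬 𝒬' :=
  fun _ φ => ⟨⟨φ.1.lift h, (φ.1.freeVars_lift h).trans φ.2⟩,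
    fun _ => forall_congr' fun α => (φ.1.sat_lift h α).symm⟩

theorem LogicLT.of_subset (h : 𝒬 ⊆ 𝒬') (φ : Sentence σ k 𝒬') (hA : A.Models φ)
    (hB : ¬ B.Models φ) (heq : ∀ ψ : Sentence σ k 𝒬, A.Models ψ ↔ B.Models ψ) :
    LogicLT k 𝒬 𝒬' := by
  refine ⟨.of_subset h, fun hle => ?_⟩
  obtain ⟨ψ, hψ⟩ := hle σ φ
  exact hB ((hψ B).2 ((heq ψ).1 ((hψ A).1 hA)))

theorem FinStr.Isomorphic.refl (A : FinStr σ) : A.Isomorphic A :=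
  ⟨Equiv.refl _, fun _ _ => Iff.rfl⟩

theorem FinStr.Isomorphic.trans {C : FinStr σ} (hAB : A.Isomorphic B) (hBC : B.Isomorphic C) :
    A.Isomorphic C := by
  obtain ⟨f, hf⟩ := hAB
  obtain ⟨g, hg⟩ := hBC
  exact ⟨f.trans g, fun i t => (hf i t).trans (hg i _)⟩

/-- The quantifier of the isomorphism type of `A`. -/
def isoTypeQuantifier (A : FinStr σ) : Quantifier where
  voc := σ
  cls := {B | A.Isomorphic B}
  iso_closed _ _ hBC hAB := FinStr.Isomorphic.trans hAB hBC

/-- The sentence `Q_K ȳ₁ … ȳₘ (R₁ ȳ₁, …, Rₘ ȳₘ)`, where `K` is the isomorphism type of `A` and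
every `ȳᵢ` is an initial segment of the variables. -/
def isoTypeSentence (A : FinStr σ) (h : ∀ i, σ.ar i ≤ k) : Sentence σ k (quantifiersOfArity k) :=
  ⟨.quant (isoTypeQuantifier A) h (fun i => Fin.castLEEmb (h i))
    fun i => .rel i (Fin.castLE (h i)),
    Set.iUnion_eq_empty.2 fun _ => Set.sdiff_eq_empty.2 subset_rfl⟩

theorem models_isoTypeSentence (A B : FinStr σ) (h : ∀ i, σ.ar i ≤ k) :
    B.Models (isoTypeSentence A h) ↔ A.Isomorphic B := by
  have hext (α : Fin k → B.carrier) (i) (b : Fin (σ.ar i) → B.carrier) :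
      (fun j => Function.extend (Fin.castLEEmb (h i)) b α (Fin.castLE (h i) j)) = b :=
    funext fun j => (Fin.castLEEmb (h i)).injective.extend_apply b α j
  have hsat (α : Fin k → B.carrier) : (isoTypeSentence A h).1.Sat B α ↔ A.Isomorphic B := by
    change A.Isomorphic (B.withRel fun i => {b | (fun j =>
      Function.extend (Fin.castLEEmb (h i)) b α (Fin.castLE (h i) j)) ∈ B.rel i}) ↔ _
    simp only [hext, Set.ofPred_mem_eq, FinStr.withRel]
  obtain ⟨b⟩ := B.nonempty
  exact ⟨fun hB => (hsat fun _ => b).1 (hB _), fun hB α => (hsat α).2 hB⟩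

theorem exists_sentence_of_not_isomorphic {A B : FinStr σ} (hσ : ∀ i, σ.ar i ≤ k)
    (h : ¬ A.Isomorphic B) :
    ∃ φ : Sentence σ k (quantifiersOfArity k), A.Models φ ∧ ¬ B.Models φ :=
  ⟨isoTypeSentence A hσ, (models_isoTypeSentence A A hσ).2 (.refl A),
    mt (models_isoTypeSentence A B hσ).1 h⟩

end Logic

section VertexSum

variable {V R : Type*} {G : SimpleGraph V}

theorem eq_of_mem_two_edges {u v : V} (huv : u ≠ v) {d e : G.edgeSet} (hud : u ∈ (d : Sym2 V))
    (hvd : v ∈ (d : Sym2 V)) (hue : u ∈ (e : Sym2 V)) (hve : v ∈ (e : Sym2 V)) : d = e :=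
  Subtype.ext (((Sym2.mem_and_mem_iff huv).1 ⟨hud, hvd⟩).trans
    ((Sym2.mem_and_mem_iff huv).1 ⟨hue, hve⟩).symm)

theorem card_filter_mem_edge_of_isBipartiteWith [DecidableEq V] {s t : Finset V}
    (h : G.IsBipartiteWith s t) (e : G.edgeSet) : (s.filter (· ∈ (e : Sym2 V))).card = 1 := by
  obtain ⟨⟨x, y⟩, he⟩ := e
  have hdisj := Finset.disjoint_right.1 (Finset.disjoint_coe.1 h.disjoint)
  rw [Finset.card_eq_one]
  rcases h.mem_of_adj he with ⟨hx, hy⟩ | ⟨hx, hy⟩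
  · exact ⟨x, by ext z; have := hdisj hy; simp; grind⟩
  · exact ⟨y, by ext z; have := hdisj hx; simp; grind⟩

variable [Finite G.edgeSet]

/-- The edges at a vertex, as a finite set of edges of the graph. -/
noncomputable def edgesAt (G : SimpleGraph V) [Finite G.edgeSet] (v : V) : Finset G.edgeSet :=
  (Set.toFinite {e : G.edgeSet | v ∈ (e : Sym2 V)}).toFinset

theorem mem_edgesAt {v : V} {e : G.edgeSet} : e ∈ edgesAt G v ↔ v ∈ (e : Sym2 V) := by
  rw [edgesAt, Set.Finite.mem_toFinset, Set.mem_ofPred_eq]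

theorem exists_ne_and_edge_eq {v : V} {e : G.edgeSet} (he : e ∈ edgesAt G v) :
    ∃ w ≠ v, (e : Sym2 V) = s(v, w) := by
  obtain ⟨w, hw⟩ := mem_edgesAt.1 he
  have hadj : G.Adj v w := G.mem_edgeSet.1 (hw ▸ e.2)
  exact ⟨w, hadj.ne', hw⟩

theorem card_edgesAt (v : V) [Fintype (G.neighborSet v)] :
    (edgesAt G v).card = G.degree v := by
  classical
  rw [← G.card_incidenceFinset_eq_degree, ← Finset.card_map (Function.Embedding.subtype _)]
  congr 1
  ext e
  simp [mem_edgesAt, SimpleGraph.incidenceSet, and_comm]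

theorem eq_of_edgesAt_subset {u v : V} (hcard : 2 ≤ (edgesAt G u).card)
    (h : edgesAt G u ⊆ edgesAt G v) : u = v := by
  by_contra huv
  obtain ⟨d, hd, e, he, hde⟩ := Finset.one_lt_card.1 hcard
  exact hde (eq_of_mem_two_edges huv (mem_edgesAt.1 hd) (mem_edgesAt.1 (h hd))
    (mem_edgesAt.1 he) (mem_edgesAt.1 (h he)))

/-- The sum of an edge labelling over the edges at a vertex, as a linear map. -/
noncomputable def vertexSum [Semiring R] (v : V) : (G.edgeSet → R) →ₗ[R] R :=
  ∑ e ∈ edgesAt G v, LinearMap.proj e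

theorem vertexSum_apply [Semiring R] (v : V) (c : G.edgeSet → R) :
    vertexSum v c = ∑ e ∈ edgesAt G v, c e := by
  rw [vertexSum, LinearMap.sum_apply]
  rfl

theorem vertexSum_congr [Semiring R] {v : V} {c d : G.edgeSet → R}
    (h : ∀ e ∈ edgesAt G v, c e = d e) : vertexSum v c = vertexSum v d := by
  simpa only [vertexSum_apply] using Finset.sum_congr rfl h

theorem vertexSum_single [Semiring R] [DecidableEq G.edgeSet] (v : V) (e : G.edgeSet) (a : R) :
    vertexSum v (Pi.single e a) = if e ∈ edgesAt G v then a else 0 := by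
  rw [vertexSum_apply, Finset.sum_pi_single']

theorem sum_eq_vertexSum [Semiring R] {ι : Type*} [Fintype ι] {v : V} {e : ι → G.edgeSet}
    (he : Function.Injective e) (hv : Set.range e = edgesAt G v) (c : G.edgeSet → R) :
    ∑ i, c (e i) = vertexSum v c := by
  classical
  have hmap : edgesAt G v = Finset.univ.map ⟨e, he⟩ := by
    rw [← Finset.coe_inj, ← hv, Finset.coe_map, Finset.coe_univ, Set.image_univ]
    rfl
  rw [vertexSum_apply, hmap, Finset.sum_map]
  rfl

theorem sum_vertexSum_eq_of_isBipartiteWith [Semiring R] {s t : Finset V}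
    (h : G.IsBipartiteWith s t) (c : G.edgeSet → R) :
    ∑ v ∈ s, vertexSum v c = ∑ v ∈ t, vertexSum v c := by
  classical
  have := Fintype.ofFinite G.edgeSet
  have sum_side {s t : Finset V} (h : G.IsBipartiteWith s t) :
      ∑ v ∈ s, vertexSum v c = ∑ e, c e :=
    calc ∑ v ∈ s, vertexSum v c
        = ∑ v ∈ s, ∑ e ∈ edgesAt G v, c e := by simp only [vertexSum_apply]
      _ = ∑ e : G.edgeSet, ∑ v ∈ s with v ∈ (e : Sym2 V), c e :=
          Finset.sum_comm' fun v e => by simp [mem_edgesAt]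
      _ = ∑ e, c e := by
          simp only [Finset.sum_const, card_filter_mem_edge_of_isBipartiteWith h, one_smul]
  exact (sum_side h).trans (sum_side h.symm).symm

theorem exists_vertexSum_eq_single_of_reachable [Ring R] [DecidableEq V] {S : Set V} {x y : S}
    (h : (G.induce S).Reachable x y) :
    ∃ g : G.edgeSet → R, (∀ e : G.edgeSet, ∀ v ∉ S, v ∈ (e : Sym2 V) → g e = 0) ∧
      ∀ z ≠ (y : V), vertexSum z g = (Pi.single (x : V) 1 : V → R) z := by
  classical
  obtain ⟨p⟩ := h
  induction p with
  | nil => exact ⟨0, fun _ _ _ _ => rfl, fun z hz => by rw [map_zero, Pi.single_eq_of_ne hz]⟩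
  | @cons x x' _ hadj _ ih =>
    obtain ⟨g, hgS, hg⟩ := ih
    have hadj : G.Adj x x' := hadj
    have hxx' : (x : V) ≠ x' := hadj.ne
    refine ⟨Pi.single ⟨s(x, x'), hadj⟩ 1 - g, fun e v hvS hve => ?_, fun z hz => ?_⟩
    · have hne : e ≠ ⟨s(x, x'), hadj⟩ := by
        rintro rfl
        rcases Sym2.mem_iff.1 hve with rfl | rfl
        exacts [hvS x.2, hvS x'.2]
      rw [Pi.sub_apply, Pi.single_eq_of_ne hne, hgS e v hvS hve, sub_zero]
    · rw [map_sub, vertexSum_single, hg z hz, Pi.single_apply, Pi.single_apply]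
      simp only [mem_edgesAt, Sym2.mem_iff]
      grind

end VertexSum

section Extension

variable {V R : Type*} [Finite V] [Ring R] {G : SimpleGraph V}

theorem exists_vertexSum_eq_of_preconnected {S : Set V}
    (h : (G.induce S).Preconnected) {w : V} (hw : w ∈ S) (s : V → R) :
    ∃ g : G.edgeSet → R, (∀ e : G.edgeSet, ∀ v ∉ S, v ∈ (e : Sym2 V) → g e = 0) ∧
      ∀ z ∈ S, z ≠ w → vertexSum z g = s z := by
  classical
  have := Fintype.ofFinite V
  choose g hgS hg using fun x : S =>
    exists_vertexSum_eq_single_of_reachable (R := R) (h x ⟨w, hw⟩)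
  refine ⟨∑ x : S, s x • g x, fun e v hvS hve => ?_, fun z hz hzw => ?_⟩
  · simp only [Finset.sum_apply, Pi.smul_apply, hgS _ e v hvS hve, smul_zero, Finset.sum_const_zero]
  · rw [map_sum, Finset.sum_eq_single ⟨z, hz⟩ _ fun h => (h (Finset.mem_univ _)).elim]
    · rw [map_smul, hg _ z hzw, Pi.single_eq_same, smul_eq_mul, mul_one]
    · intro x _ hxz
      have hzx : z ≠ x := fun h => hxz (Subtype.ext h.symm)
      rw [map_smul, hg x z hzw, Pi.single_eq_of_ne hzx, smul_zero]

theorem exists_vertexSum_eq_extending {v w : V}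
    (h : (G.induce {v}ᶜ).Preconnected) (hwv : w ≠ v) (c : G.edgeSet → R) (s : V → R) :
    ∃ c' : G.edgeSet → R, (∀ e ∈ edgesAt G v, c' e = c e) ∧
      ∀ u, u ≠ v → u ≠ w → vertexSum u c' = s u := by
  obtain ⟨g, hgv, hg⟩ := exists_vertexSum_eq_of_preconnected h hwv fun u => s u - vertexSum u c
  refine ⟨c + g, fun e he => ?_, fun u huv huw => ?_⟩
  · rw [Pi.add_apply, hgv e v (not_not.2 rfl) (mem_edgesAt.1 he), add_zero]
  · rw [map_add, hg u huv huw, add_sub_cancel]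

end Extension

section ZModFour

/-- The classes that distinguish `R₀` from `R₁`: sums in `{0, 1}` are low, the others are not. -/
def IsLow (x : ZMod 4) : Prop :=
  x = 0 ∨ x = 1

instance : DecidablePred IsLow :=
  fun _ => inferInstanceAs (Decidable (_ ∨ _))

/-- The summand `τ` for which `x ↦ ε * x + τ` maps `{0, 1}` to itself, for `ε = 1` and `ε = -1`.
It is a natural number, because the double counting over a bipartition divides by the degree. -/
def lowOffset (ε : ZMod 4) : ℕ :=
  if ε = 1 then 0 else 1

theorem isLow_affine_iff : ∀ (ε : (ZMod 4)ˣ) (x : ZMod 4),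
    IsLow (ε * x + lowOffset ε) ↔ IsLow x := by
  decide

theorem exists_affine_eq_of_isLow_iff : ∀ x y : ZMod 4, (IsLow x ↔ IsLow y) →
    ∃ ε : (ZMod 4)ˣ, ε * x + lowOffset ε = y := by
  decide

theorem exists_shift_isLow_iff : ∀ x y : ZMod 4,
    ∃ δ, (IsLow x ↔ IsLow (y + δ)) ∧ (IsLow x ↔ IsLow (y + (δ + δ))) := by
  decide

theorem eq_unit_of_isLow : ∀ x u w : ZMod 4, IsLow x → IsLow (x + u) → IsLow (x + w) →
    ¬ IsLow (x + u + w) → ∃ ε : (ZMod 4)ˣ, u = ε ∧ w = ε ∧ x = lowOffset ε := by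
  decide

theorem units_mul_two : ∀ ε : (ZMod 4)ˣ, (ε : ZMod 4) * 2 = 2 := by
  decide

theorem lowOffset_inv : ∀ ε : (ZMod 4)ˣ,
    (lowOffset ↑ε⁻¹ : ZMod 4) = -(↑ε⁻¹ * (lowOffset ε : ZMod 4)) := by
  decide

theorem mem_class_iff : ∀ (j : Fin 2) (x : ZMod 4),
    x ∈ (![{0, 1}, {2, 3}] : Fin 2 → Set (ZMod 4)) j ↔ (IsLow x ↔ j = 0) := by
  intro j
  fin_cases j
  · simp [IsLow]
  · change ∀ x : ZMod 4, x = 2 ∨ x = 3 ↔ (IsLow x ↔ (1 : Fin 2) = 0)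
    decide

end ZModFour

section Gadgets

theorem exists_strictMono_comp_range_eq {E K : Type*} [LinearOrder K] {κ : E → K}
    (hκ : Function.Injective κ) {k : ℕ} {S : Finset E} (hcard : S.card = k) :
    ∃ e : Fin k → E, StrictMono (κ ∘ e) ∧ Set.range e = S := by
  let _ : LinearOrder E := LinearOrder.lift' κ hκ
  have hmono : StrictMono κ := fun _ _ => id
  exact ⟨S.orderEmbOfFin hcard, hmono.comp (S.orderEmbOfFin hcard).strictMono,
    Finset.range_orderEmbOfFin S hcard⟩

variable {V : Type} [LinearOrder V] {G : SimpleGraph V} {k : ℕ} {U : Set V} {v : V}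

theorem edgeKey_injective : Function.Injective (edgeKey : G.edgeSet → V ×ₗ V) := by
  intro d e h
  have h' := Prod.ext_iff.1 (toLex.injective h)
  exact Subtype.ext (Sym2.inf_eq_inf_and_sup_eq_sup.1 h')

/-- The charge of a vertex of `cfi G k U`. -/
noncomputable def charge (U : Set V) (v : V) : ZMod 4 :=
  U.indicator 1 v

variable [Finite G.edgeSet]

/-- The list of the edges at a vertex in increasing order. -/
def EnumeratesEdgesAt (v : V) (e : Fin k → G.edgeSet) : Prop :=
  StrictMono (edgeKey ∘ e) ∧ Set.range e = edgesAt G v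

theorem EnumeratesEdgesAt.injective {e : Fin k → G.edgeSet} (he : EnumeratesEdgesAt v e) :
    Function.Injective e :=
  he.1.injective.of_comp

theorem exists_enumeratesEdgesAt (hcard : (edgesAt G v).card = k) :
    ∃ e : Fin k → G.edgeSet, EnumeratesEdgesAt v e :=
  exists_strictMono_comp_range_eq edgeKey_injective hcard

theorem mem_gadgetRel_iff {s : ZMod 4} {j : Fin 2} {t : Fin k → G.edgeSet × ZMod 4} :
    t ∈ gadgetRel G k v s j ↔
      EnumeratesEdgesAt v (Prod.fst ∘ t) ∧ (IsLow (∑ i, (t i).2 - 2 * s) ↔ j = 0) := by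
  have hrange : Set.range (fun i => ((t i).1 : Sym2 V)) = G.incidenceSet v ↔
      Set.range (Prod.fst ∘ t) = edgesAt G v := by
    have himage : G.incidenceSet v = Subtype.val '' (edgesAt G v : Set G.edgeSet) := by
      ext e
      simp [SimpleGraph.incidenceSet, mem_edgesAt, and_comm]
    rw [himage, ← (Set.image_injective.2 Subtype.val_injective).eq_iff, ← Set.range_comp]
    rfl
  rw [← mem_class_iff, EnumeratesEdgesAt, ← hrange, and_assoc]
  rfl

theorem mem_cfiRel_iff {j : Fin 2} {t : Fin k → G.edgeSet × ZMod 4} :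
    t ∈ cfiRel G k U j ↔ ∃ v, EnumeratesEdgesAt v (Prod.fst ∘ t) ∧
      (IsLow (∑ i, (t i).2 - 2 * charge U v) ↔ j = 0) := by
  have hcharge (v) : t ∈ gadgetRel G k v (charge U v) j ↔
      v ∉ U ∧ t ∈ gadgetRel G k v 0 j ∨ v ∈ U ∧ t ∈ gadgetRel G k v 1 j := by
    by_cases hv : v ∈ U <;> simp [charge, hv]
  simp only [← mem_gadgetRel_iff, hcharge, cfiRel, exists_or, Set.mem_union, Set.mem_iUnion,
    Set.mem_compl_iff, exists_prop]

theorem mem_cfiRel_zero_iff (hcard : 2 ≤ (edgesAt G v).card) {e : Fin k → G.edgeSet}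
    (he : EnumeratesEdgesAt v e) (c : G.edgeSet → ZMod 4) :
    (fun i => (e i, c (e i))) ∈ cfiRel G k U 0 ↔ IsLow (vertexSum v c - 2 * charge U v) := by
  simp only [mem_cfiRel_iff, sum_eq_vertexSum he.injective he.2, iff_true]
  constructor
  · rintro ⟨u, hu, hlow⟩
    obtain rfl : v = u := eq_of_edgesAt_subset hcard (Finset.coe_subset.1 (he.2 ▸ hu.2.le))
    exact hlow
  · exact fun hlow => ⟨v, he, hlow⟩

end Gadgets

section Pebbles

variable {E X : Type*} {k : ℕ} {α : Fin k → Option (E × X)}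

/-- The edges whose fibre contains a pebble. -/
noncomputable def pebbledEdges (α : Fin k → Option (E × X)) : Finset E := by
  classical exact (Finset.univ.image α).eraseNone.image Prod.fst

theorem mem_pebbledEdges {e : E} : e ∈ pebbledEdges α ↔ ∃ a x, α x = some (e, a) := by
  simp [pebbledEdges]

theorem card_pebbledEdges_le (α : Fin k → Option (E × X)) : (pebbledEdges α).card ≤ k := by
  classical
  calc (pebbledEdges α).card
      ≤ (Finset.univ.image α).eraseNone.card := Finset.card_image_le
    _ ≤ (Finset.univ.image α).card := by convert Finset.card_eraseNone_le _
    _ ≤ k := Finset.card_image_le.trans_eq (Finset.card_fin k)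

theorem exists_eq_some_of_subset_pebbledEdges [Nonempty X] {S : Finset E}
    (hS : S ⊆ pebbledEdges α) (hcard : S.card = k) :
    ∃ p : E → X, ∀ x, ∃ e ∈ S, α x = some (e, p e) := by
  classical
  choose! p hp using fun e (he : e ∈ S) => mem_pebbledEdges.1 (hS he)
  have himage : S.image (fun e => some (e, p e)) = Finset.univ.image α := by
    refine Finset.eq_of_subset_of_card_le (fun o ho => ?_) ?_
    · obtain ⟨e, he, rfl⟩ := Finset.mem_image.1 ho
      obtain ⟨x, hx⟩ := hp e he
      exact Finset.mem_image.2 ⟨x, Finset.mem_univ x, hx⟩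
    · have hinj : Function.Injective fun e => some (e, p e) :=
        fun d e h => congrArg Prod.fst (Option.some_injective _ h)
      rw [Finset.card_image_of_injective _ hinj, hcard]
      exact Finset.card_image_le.trans_eq (Finset.card_fin k)
  refine ⟨p, fun x => ?_⟩
  obtain ⟨e, he, hx⟩ := Finset.mem_image.1 (himage ▸ Finset.mem_image_of_mem α (Finset.mem_univ x))
  exact ⟨e, he, hx.symm⟩

end Pebbles

section Shears

variable {E R : Type*} [Ring R]

/-- The fibrewise affine permutation `(e, a) ↦ (e, ε * a + c e)`. -/
def affineShear (ε : Rˣ) (c : E → R) : E × R ≃ E × R :=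
  Equiv.prodShear (Equiv.refl E) fun e => (Units.mulLeft ε).trans (Equiv.addRight (c e))

theorem affineShear_apply (ε : Rˣ) (c : E → R) (p : E × R) :
    affineShear ε c p = (p.1, ε * p.2 + c p.1) :=
  rfl

theorem affineShear_symm (ε : Rˣ) (c : E → R) :
    (affineShear ε c).symm = affineShear ε⁻¹ (-((↑ε⁻¹ : R) • c)) := by
  ext1 p
  rw [Equiv.symm_apply_eq]
  simp [affineShear_apply, mul_add]

variable {k : ℕ} {α : Fin k → Option (E × R)}

theorem pebbledEdges_map_affineShear (ε : Rˣ) (c : E → R) :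
    pebbledEdges (Option.map (affineShear ε c) ∘ α) = pebbledEdges α := by
  ext e
  simp only [mem_pebbledEdges, Function.comp_apply, Option.map_eq_some_iff, affineShear_apply]
  constructor
  · rintro ⟨_, x, ⟨_, a⟩, hx, ⟨⟩⟩
    exact ⟨a, x, hx⟩
  · rintro ⟨a, x, hx⟩
    exact ⟨_, x, _, hx, rfl⟩

theorem map_affineShear_congr {ε ε' : Rˣ} {c c' : E → R}
    (h : ∀ x e a, α x = some (e, a) → ε * a + c e = ε' * a + c' e) :
    Option.map (affineShear ε c) ∘ α = Option.map (affineShear ε' c') ∘ α := by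
  ext1 x
  rcases hx : α x with _ | ⟨e, a⟩
  · simp only [Function.comp_apply, hx, Option.map_none]
  · simp only [Function.comp_apply, hx, Option.map_some, affineShear_apply, h x e a hx]

theorem extend_map_affineShear {ε : Rˣ} {c c' : E → R} (h : ∀ e ∈ pebbledEdges α, c e = c' e)
    {r : ℕ} (y : Fin r → Fin k) (a : Fin r → E × R) :
    Function.extend y (fun j => some (affineShear ε c' (a j)))
        (Option.map (affineShear ε c) ∘ α) =
      Option.map (affineShear ε c') ∘ Function.extend y (fun j => some (a j)) α := by
  have hα : Option.map (affineShear ε c) ∘ α = Option.map (affineShear ε c') ∘ α :=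
    map_affineShear_congr fun x e a hx => by rw [h e (mem_pebbledEdges.2 ⟨a, x, hx⟩)]
  rw [hα]
  ext1 x
  exact (Function.apply_extend (Option.map (affineShear ε c')) y α
    (g := fun j => some (a j)) x).symm

theorem comp_mem_maltsevClosure_of_shifts {E R : Type} [Ring R] [DecidableEq E] {d e : E}
    (hde : d ≠ e) (ε : Rˣ) (c : E → R) (δ : R) {r : ℕ} (a : Fin r → E × R) :
    affineShear ε c ∘ a ∈ MaltsevClosure (Set.range fun i : Fin 3 => affineShear ε
      (c + (Pi.single d (![δ, δ, 0] i) + Pi.single e (![0, δ, δ] i))) ∘ a) := by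
  refine MaltsevClosure.step (.base ⟨0, rfl⟩) (.base ⟨1, rfl⟩) (.base ⟨2, rfl⟩) fun j => ?_
  by_cases hd : (a j).1 = d
  · left
    simp [affineShear_apply, hd, hde]
  · right
    simp [affineShear_apply, hd]

end Shears

section Game

variable {V : Type} [Finite V] {G : SimpleGraph V} {k : ℕ} {U U' : Set V} {v : V}
  {ε : (ZMod 4)ˣ} {c : G.edgeSet → ZMod 4} {α β : Fin k → Option (G.edgeSet × ZMod 4)}

/-- The affine shear with parameters `ε` and `c` maps the gadget of `u` in `cfi G k U` to its gadget
in `cfi G k U'`, see `PreservesGadget.isLow_iff`. -/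
def PreservesGadget (U U' : Set V) (ε : (ZMod 4)ˣ) (c : G.edgeSet → ZMod 4) (u : V) : Prop :=
  vertexSum u c = lowOffset ε + 2 * (charge U' u - charge U u)

theorem PreservesGadget.isLow_iff (h : PreservesGadget U U' ε c v) (x : ZMod 4) :
    IsLow (ε * x + vertexSum v c - 2 * charge U' v) ↔ IsLow (x - 2 * charge U v) := by
  rw [← isLow_affine_iff ε (x - 2 * charge U v), h]
  congr! 1
  linear_combination (charge U v) * units_mul_two ε

theorem PreservesGadget.symm (h : PreservesGadget U U' ε c v) :
    PreservesGadget U' U ε⁻¹ (-((↑ε⁻¹ : ZMod 4) • c)) v := by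
  rw [PreservesGadget, map_neg, map_smul, h, smul_eq_mul, lowOffset_inv]
  linear_combination (charge U v - charge U' v) * units_mul_two ε⁻¹

theorem affineShear_comp_mem_cfiRel_iff [LinearOrder V] {t : Fin k → G.edgeSet × ZMod 4} {j : Fin 2}
    (h : ∀ u, EnumeratesEdgesAt u (Prod.fst ∘ t) → PreservesGadget U U' ε c u) :
    affineShear ε c ∘ t ∈ cfiRel G k U' j ↔ t ∈ cfiRel G k U j := by
  rw [mem_cfiRel_iff, mem_cfiRel_iff]
  refine exists_congr fun u => and_congr_right fun hu => ?_
  have hsum : ∑ i, ((affineShear ε c ∘ t) i).2 = ε * ∑ i, (t i).2 + vertexSum u c := by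
    rw [← sum_eq_vertexSum hu.injective hu.2, Finset.mul_sum, ← Finset.sum_add_distrib]
    rfl
  rw [hsum, (h u hu).isLow_iff]

/-- The positions in which Duplicator stays: the pebbles are matched by an affine shear that
preserves all gadgets but one, and that one is not completely pebbled. -/
def IsShearPosition (U U' : Set V) (α β : Fin k → Option (G.edgeSet × ZMod 4)) : Prop :=
  ∃ ε c, β = Option.map (affineShear ε c) ∘ α ∧
    ∃ v, (∀ u ≠ v, PreservesGadget U U' ε c u) ∧ ∃ e ∈ edgesAt G v, e ∉ pebbledEdges α

theorem IsShearPosition.symm (h : IsShearPosition U U' α β) : IsShearPosition U' U β α := by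
  obtain ⟨ε, c, rfl, v, hpres, hfree⟩ := h
  refine ⟨ε⁻¹, _, ?_, v, fun u hu => (hpres u hu).symm, ?_⟩
  · rw [← affineShear_symm, ← Function.comp_assoc, Option.map_comp_map, Equiv.symm_comp_self,
      Option.map_id, Function.id_comp]
  · rwa [pebbledEdges_map_affineShear]

theorem isShearPosition_empty (hv : (edgesAt G v).Nonempty)
    (h : ∀ u ≠ v, charge U u = charge U' u) :
    IsShearPosition U U' (k := k) (G := G) (fun _ => none) (fun _ => none) := by
  obtain ⟨e, he⟩ := hv
  refine ⟨1, 0, rfl, v, fun u hu => ?_, e, he, fun he => ?_⟩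
  · rw [PreservesGadget, map_zero, h u hu, sub_self, mul_zero]
    rfl
  · obtain ⟨_, _, h⟩ := mem_pebbledEdges.1 he
    exact Option.some_ne_none _ h.symm

theorem one_lt_card_sdiff_of_inter_subset {E : Type*} [DecidableEq E] {A B P : Finset E} {e : E}
    (hA : (A \ P).card ≤ 1) (hPA : P.card ≤ A.card) (hB : 3 ≤ B.card) (hAB : A ∩ B ⊆ {e})
    (he : e ∉ P) : 1 < (B \ P).card := by
  have hsub : B ∩ P ⊆ P \ A := fun d hd => by
    obtain ⟨hdB, hdP⟩ := Finset.mem_inter.1 hd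
    refine Finset.mem_sdiff.2 ⟨hdP, fun hdA => he ?_⟩
    rwa [← Finset.mem_singleton.1 (hAB (Finset.mem_inter.2 ⟨hdA, hdB⟩))]
  have := Finset.card_le_card hsub
  have := Finset.card_inter_add_card_sdiff B P
  have := Finset.card_sdiff_le_card_sdiff_iff.2 hPA
  omega

theorem exists_preservesGadget_add_single [DecidableEq G.edgeSet] {w : V} {e : G.edgeSet}
    (he : (e : Sym2 V) = s(v, w)) (h : ∀ u ≠ v, PreservesGadget U U' ε c u) :
    ∃ δ, ∀ u ≠ w, PreservesGadget U U' ε (c + Pi.single e δ) u := by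
  refine ⟨lowOffset ε + 2 * (charge U' v - charge U v) - vertexSum v c, fun u huw => ?_⟩
  rw [PreservesGadget, map_add, vertexSum_single]
  by_cases huv : u = v
  · rw [huv, if_pos (mem_edgesAt.2 (he ▸ Sym2.mem_mk_left v w)), add_sub_cancel]
  · have heu : e ∉ edgesAt G u := by
      rw [mem_edgesAt, he, Sym2.mem_iff]
      exact not_or.2 ⟨huv, huw⟩
    rw [if_neg heu, add_zero, h u huv]

/-- If `v` has no free edge but `e`, then `e` is its free edge to a vertex `w` at which there is
at most one pebble; shifting the fibre of `e` makes `w` the exceptional vertex. -/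
theorem IsShearPosition.exists_two_free_edges (h : IsShearPosition U U' α β) (hk : 3 ≤ k)
    (hcard : ∀ u, (edgesAt G u).card = k) :
    ∃ ε c, β = Option.map (affineShear ε c) ∘ α ∧
      ∃ v, (∀ u ≠ v, PreservesGadget U U' ε c u) ∧
        ∃ d ∈ edgesAt G v, d ∉ pebbledEdges α ∧
          ∃ e ∈ edgesAt G v, e ∉ pebbledEdges α ∧ d ≠ e := by
  classical
  suffices h : ∃ ε c, β = Option.map (affineShear ε c) ∘ α ∧
      ∃ v, (∀ u ≠ v, PreservesGadget U U' ε c u) ∧ 1 < (edgesAt G v \ pebbledEdges α).card by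
    simpa only [Finset.one_lt_card, Finset.mem_sdiff, and_assoc] using h
  obtain ⟨ε, c, rfl, v, hpres, e, hev, hfree⟩ := h
  by_cases hfew : 1 < (edgesAt G v \ pebbledEdges α).card
  · exact ⟨ε, c, rfl, v, hpres, hfew⟩
  obtain ⟨w, hwv, he⟩ := exists_ne_and_edge_eq hev
  have hew : e ∈ edgesAt G w := mem_edgesAt.2 (he ▸ Sym2.mem_mk_right v w)
  obtain ⟨δ, hδ⟩ := exists_preservesGadget_add_single he hpres
  refine ⟨ε, c + Pi.single e δ, map_affineShear_congr fun x d a hx => ?_, w, hδ, ?_⟩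
  · have hde : d ≠ e := fun hde => hfree (mem_pebbledEdges.2 ⟨a, x, hde ▸ hx⟩)
    rw [Pi.add_apply, Pi.single_eq_of_ne hde, add_zero]
  · refine one_lt_card_sdiff_of_inter_subset (not_lt.1 hfew)
      ((card_pebbledEdges_le α).trans_eq (hcard v).symm) (hk.trans_eq (hcard w).symm)
      (fun d hd => ?_) hfree
    obtain ⟨hdv, hdw⟩ := Finset.mem_inter.1 hd
    exact Finset.mem_singleton.2 (eq_of_mem_two_edges hwv (mem_edgesAt.1 hdw) (mem_edgesAt.1 hdv)
      (mem_edgesAt.1 hew) (mem_edgesAt.1 hev))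

theorem isShearPosition_of_saturated (hG : (G.induce {v}ᶜ).Preconnected)
    (hcard : ∀ u, 2 ≤ (edgesAt G u).card) {p : G.edgeSet → ZMod 4}
    (hp : ∀ x, ∃ e ∈ edgesAt G v, α x = some (e, p e))
    (hlow : IsLow (vertexSum v p - 2 * charge U v) ↔
      IsLow (ε * vertexSum v p + vertexSum v c - 2 * charge U' v)) :
    IsShearPosition U U' α (Option.map (affineShear ε c) ∘ α) := by
  obtain ⟨ε', hε'⟩ := exists_affine_eq_of_isLow_iff _ _ hlow
  obtain ⟨e, he⟩ : (edgesAt G v).Nonempty := Finset.card_pos.1 (two_pos.trans_le (hcard v))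
  obtain ⟨w, hwv, -⟩ := exists_ne_and_edge_eq he
  obtain ⟨c', hc', hsum⟩ := exists_vertexSum_eq_extending hG hwv
    ((ε : ZMod 4) • p + c - (ε' : ZMod 4) • p)
    fun u => lowOffset ε' + 2 * (charge U' u - charge U u)
  refine ⟨ε', c', map_affineShear_congr fun x d a hx => ?_, w, fun u huw => ?_, ?_⟩
  · obtain ⟨d', hd', hx'⟩ := hp x
    obtain ⟨rfl, rfl⟩ := Prod.mk.inj (Option.some_injective _ (hx.symm.trans hx'))
    rw [hc' d hd']
    simp only [Pi.add_apply, Pi.sub_apply, Pi.smul_apply, smul_eq_mul]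
    ring
  · by_cases huv : u = v
    · rw [huv, PreservesGadget, vertexSum_congr hc', map_sub, map_add, map_smul, map_smul]
      simp only [smul_eq_mul]
      linear_combination (-hε') - (charge U v) * units_mul_two ε'
    · exact hsum u huv huw
  · by_contra! hall
    refine hwv (eq_of_edgesAt_subset (hcard w) fun d hd => ?_)
    obtain ⟨a, x, hx⟩ := mem_pebbledEdges.1 (hall d hd)
    obtain ⟨d', hd', hx'⟩ := hp x
    obtain ⟨rfl, -⟩ := Prod.mk.inj (Option.some_injective _ (hx.symm.trans hx'))
    exact hd'

/-- Once Spoiler has pebbled all edges at the exceptional vertex `v`, Duplicator shifts two of them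
so that low tuples stay low. Shifting only the first, both, or only the second of them by the same
amount serves this purpose, and the Maltsev operation cancels the shifts. -/
theorem IsShearPosition.uniformMove (hα : IsShearPosition U U' α β) (hk : 3 ≤ k)
    (hcard : ∀ u, (edgesAt G u).card = k) (hG : ∀ v, (G.induce {v}ᶜ).Preconnected) :
    ∃ f : G.edgeSet × ZMod 4 ≃ G.edgeSet × ZMod 4, ∀ (r : ℕ) (y : Fin r ↪ Fin k)
      (a : Fin r → G.edgeSet × ZMod 4), ∃ p : Fin 3 → Fin r → G.edgeSet × ZMod 4,
        f ∘ a ∈ MaltsevClosure (Set.range p) ∧ ∀ b ∈ Set.range p, IsShearPosition U U'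
          (Function.extend y (fun j => some (a j)) α)
          (Function.extend y (fun j => some (b j)) β) := by
  classical
  obtain ⟨ε, c, rfl, v, hpres, d, hdv, hdα, e, hev, heα, hde⟩ :=
    hα.exists_two_free_edges hk hcard
  refine ⟨affineShear ε c, fun r y a => ?_⟩
  set α' : Fin k → Option (G.edgeSet × ZMod 4) := Function.extend y (fun j => some (a j)) α
  by_cases hsat : edgesAt G v ⊆ pebbledEdges α'
  · obtain ⟨p, hp⟩ := exists_eq_some_of_subset_pebbledEdges hsat (hcard v)
    obtain ⟨δ, hδ, hδδ⟩ := exists_shift_isLow_iff (vertexSum v p - 2 * charge U v)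
      (ε * vertexSum v p + vertexSum v c - 2 * charge U' v)
    refine ⟨_, comp_mem_maltsevClosure_of_shifts hde ε c δ a, ?_⟩
    rintro _ ⟨i, rfl⟩
    set c' : G.edgeSet → ZMod 4 := c + (Pi.single d (![δ, δ, 0] i) + Pi.single e (![0, δ, δ] i))
    have hpebbled : ∀ x ∈ pebbledEdges α, c x = c' x := by
      intro x hx
      have hxd : x ≠ d := fun h => hdα (h ▸ hx)
      have hxe : x ≠ e := fun h => heα (h ▸ hx)
      simp [c', hxd, hxe]
    have hsum : vertexSum v c' = vertexSum v c + (![δ, δ, 0] i + ![0, δ, δ] i) := by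
      simp only [c', map_add, vertexSum_single, hdv, hev, if_true]
    have hlow : IsLow (vertexSum v p - 2 * charge U v) ↔
        IsLow (ε * vertexSum v p + vertexSum v c' - 2 * charge U' v) := by
      rw [hsum, ← add_assoc, add_sub_right_comm]
      fin_cases i
      · simpa using hδ
      · simpa using hδδ
      · simpa using hδ
    have := isShearPosition_of_saturated (hG v) (fun u => hcard u ▸ Nat.le_of_succ_le hk) hp hlow
    rwa [← extend_map_affineShear hpebbled] at this
  · refine ⟨fun _ => affineShear ε c ∘ a, MaltsevClosure.base ⟨0, rfl⟩, ?_⟩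
    rintro _ ⟨-, rfl⟩
    exact ⟨ε, c, extend_map_affineShear (fun _ _ => rfl) y a, v, hpres, Finset.not_subset.1 hsat⟩

theorem IsShearPosition.cfiRel_iff [LinearOrder V] (h : IsShearPosition U U' α β)
    {t t' : Fin k → G.edgeSet × ZMod 4} {x : Fin k → Fin k} (ht : ∀ i, α (x i) = some (t i))
    (ht' : ∀ i, β (x i) = some (t' i)) (j : Fin 2) : t ∈ cfiRel G k U j ↔ t' ∈ cfiRel G k U' j := by
  obtain ⟨ε, c, rfl, v, hpres, e, hev, hfree⟩ := h
  obtain rfl : affineShear ε c ∘ t = t' :=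
    funext fun i => Option.some_injective _ ((congrArg _ (ht i)).symm.trans (ht' i))
  refine (affineShear_comp_mem_cfiRel_iff fun u hu => hpres u ?_).symm
  rintro rfl
  obtain ⟨i, rfl⟩ : e ∈ Set.range (Prod.fst ∘ t) := hu.2 ▸ hev
  exact hfree (mem_pebbledEdges.2 ⟨_, x i, ht i⟩)

end Game

section CfiGame

variable {V : Type} [Fintype V] [LinearOrder V] {G : SimpleGraph V} [Nonempty G.edgeSet] {k : ℕ}
  {U U' : Set V}

theorem IsShearPosition.isPartialIso {α : PartialAssignment k (cfi G k U)}
    {β : PartialAssignment k (cfi G k U')} (h : IsShearPosition U U' α β) :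
    IsPartialIso (cfi G k U) (cfi G k U') α β := by
  obtain ⟨ε, c, rfl, h⟩ := h
  replace h : IsShearPosition U U' α (Option.map (affineShear ε c) ∘ α) := ⟨ε, c, rfl, h⟩
  refine ⟨fun x => Option.map_eq_none_iff.symm,
    fun x y => (Option.map_injective (affineShear ε c).injective).eq_iff.symm, fun i => ?_⟩
  fin_cases i
  · exact fun x a b ha hb => h.cfiRel_iff ha hb 0
  · exact fun x a b ha hb => h.cfiRel_iff ha hb 1
  · intro x a b ha hb
    obtain rfl : affineShear ε c ∘ a = b :=
      funext fun j => Option.some_injective _ ((congrArg _ (ha j)).symm.trans (hb j))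
    exact Iff.rfl

theorem isUniformStrategy_isShearPosition (hk : 3 ≤ k) (hcard : ∀ v, (edgesAt G v).card = k)
    (hG : ∀ v, (G.induce {v}ᶜ).Preconnected) (U U' : Set V) :
    IsUniformStrategy (k := k) (cfi G k U) (cfi G k U') (IsShearPosition U U') := by
  refine fun α β h => ⟨h.isPartialIso, h.uniformMove hk hcard hG, ?_⟩
  obtain ⟨g, hg⟩ := h.symm.uniformMove hk hcard hG
  refine ⟨g, fun r y a => ?_⟩
  obtain ⟨p, hp, hpW⟩ := hg r y a
  exact ⟨p, hp, fun b hb => (hpW b hb).symm⟩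

end CfiGame

section Rigidity

theorem fst_eq_of_le_iff_le {E X K : Type*} [Finite E] [LinearOrder K] {κ : E → K}
    (hκ : Function.Injective κ) {f : E × X → E × X}
    (hf : ∀ p q, κ p.1 ≤ κ q.1 ↔ κ (f p).1 ≤ κ (f q).1) (p : E × X) : (f p).1 = p.1 := by
  let _ : LinearOrder E := LinearOrder.lift' κ hκ
  have hmono : StrictMono fun e => (f (e, p.2)).1 :=
    fun d e hde => lt_of_not_ge fun h => hde.not_ge ((hf (e, p.2) (d, p.2)).2 h)
  exact le_antisymm (hmono.apply_le (x := p.1)) hmono.le_apply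

variable {V : Type} {G : SimpleGraph V} {k : ℕ} {U : Set V} {v : V} [Finite G.edgeSet]
  {π : G.edgeSet → ZMod 4 → ZMod 4}

/-- A low value stays low under each of the shifts `u` and `w` but not under `u + w` only if
`u = w` is a unit. -/
theorem exists_unit_of_isLow_iff
    (hπ : ∀ c, IsLow (vertexSum v c) ↔
      IsLow (vertexSum v (fun e => π e (c e)) - 2 * charge U v))
    {d e : G.edgeSet} (hd : d ∈ edgesAt G v) (he : e ∈ edgesAt G v) (hde : d ≠ e) :
    ∃ ε : (ZMod 4)ˣ, π d 1 - π d 0 = ε ∧ π e 1 - π e 0 = ε ∧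
      vertexSum v (fun e => π e 0) = 2 * charge U v + lowOffset ε := by
  classical
  have hlow (a b : ZMod 4) : IsLow (a + b) ↔ IsLow
      (vertexSum v (fun e => π e 0) - 2 * charge U v + (π d a - π d 0) + (π e b - π e 0)) := by
    have hfun : (fun x => π x ((Pi.single d a + Pi.single e b : G.edgeSet → ZMod 4) x)) =
        (fun x => π x 0) + (Pi.single d (π d a - π d 0) + Pi.single e (π e b - π e 0)) := by
      ext x
      by_cases hxd : x = d
      · simp [hxd, hde]
      · by_cases hxe : x = e <;> simp [hxd, hxe, hde.symm]
    have h := hπ (Pi.single d a + Pi.single e b)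
    simp only [hfun, map_add, vertexSum_single, hd, he, if_true] at h
    rw [h]
    congr! 1
    ring
  obtain ⟨ε, hdε, heε, hε⟩ := eq_unit_of_isLow _ _ _ (by simpa [IsLow] using hlow 0 0)
    (by simpa [IsLow] using hlow 1 0) (by simpa [IsLow] using hlow 0 1)
    (mt (hlow 1 1).2 (by decide))
  exact ⟨ε, hdε, heε, by rw [← hε, add_sub_cancel]⟩

theorem exists_nat_vertexSum_eq (hcard : 2 ≤ (edgesAt G v).card)
    (hπ : ∀ c, IsLow (vertexSum v c) ↔
      IsLow (vertexSum v (fun e => π e (c e)) - 2 * charge U v)) :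
    ∃ n : ℕ, vertexSum v (fun e => lowOffset (π e 1 - π e 0)) = (edgesAt G v).card * n ∧
      vertexSum v (fun e => π e 0) = 2 * charge U v + n := by
  obtain ⟨d, hd, e, he, hde⟩ := Finset.one_lt_card.1 hcard
  obtain ⟨ε, hdε, -, hε⟩ := exists_unit_of_isLow_iff hπ hd he hde
  refine ⟨lowOffset ε, ?_, hε⟩
  rw [vertexSum_apply, Finset.sum_eq_card_nsmul, smul_eq_mul]
  intro x hx
  by_cases hxd : x = d
  · rw [hxd, hdε]
  · obtain ⟨ε', hdε', hxε', -⟩ := exists_unit_of_isLow_iff hπ hd hx (Ne.symm hxd)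
    rw [hxε', ← hdε', hdε]

/-- Double counting of the signs `π e 1 - π e 0`, in `ℕ` so as to cancel the degree. -/
theorem two_mul_sum_charge_eq (hk : 2 ≤ k) (hcard : ∀ v, (edgesAt G v).card = k) {s t : Finset V}
    (hst : G.IsBipartiteWith s t)
    (hπ : ∀ v c, IsLow (vertexSum v c) ↔
      IsLow (vertexSum v (fun e => π e (c e)) - 2 * charge U v)) :
    2 * ∑ v ∈ s, charge U v = 2 * ∑ v ∈ t, charge U v := by
  choose n hn hU using fun v => exists_nat_vertexSum_eq (hk.trans_eq (hcard v).symm) (hπ v)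
  have hnst : ∑ v ∈ s, n v = ∑ v ∈ t, n v := by
    refine Nat.eq_of_mul_eq_mul_left (two_pos.trans_le hk) ?_
    simpa only [hn, hcard, ← Finset.mul_sum] using
      sum_vertexSum_eq_of_isBipartiteWith hst fun e => lowOffset (π e 1 - π e 0)
  have hsum := sum_vertexSum_eq_of_isBipartiteWith hst fun e => π e 0
  simp only [hU, Finset.sum_add_distrib, ← Finset.mul_sum, ← Nat.cast_sum, hnst] at hsum
  exact add_right_cancel hsum

end Rigidity

section NotIsomorphic

variable {V : Type} [Fintype V] [LinearOrder V] {G : SimpleGraph V} [Nonempty G.edgeSet] {k : ℕ}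

theorem exists_fiberwise_of_isomorphic {U : Set V} (hk : 2 ≤ k)
    (hcard : ∀ v, (edgesAt G v).card = k) (h : (cfi G k ∅).Isomorphic (cfi G k U)) :
    ∃ π : G.edgeSet → ZMod 4 → ZMod 4, ∀ v c, IsLow (vertexSum v c) ↔
      IsLow (vertexSum v (fun e => π e (c e)) - 2 * charge U v) := by
  obtain ⟨f, hf⟩ := h
  have hfst (p : G.edgeSet × ZMod 4) : (f p).1 = p.1 :=
    fst_eq_of_le_iff_le edgeKey_injective (fun p q => hf 2 ![p, q]) p
  refine ⟨fun e a => (f (e, a)).2, fun v c => ?_⟩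
  obtain ⟨e, he⟩ := exists_enumeratesEdgesAt (hcard v)
  have hcard : 2 ≤ (edgesAt G v).card := hk.trans_eq (hcard v).symm
  have hfe : (fun i => f (e i, c (e i))) = fun i => (e i, (f (e i, c (e i))).2) :=
    funext fun i => Prod.ext (hfst _) rfl
  have hrel : (fun i => (e i, c (e i))) ∈ cfiRel G k ∅ 0 ↔
      (fun i => (e i, (f (e i, c (e i))).2)) ∈ cfiRel G k U 0 :=
    hfe ▸ hf 0 fun i => (e i, c (e i))
  have h := (mem_cfiRel_zero_iff hcard he c).symm.trans
    (hrel.trans (mem_cfiRel_zero_iff hcard he fun e => (f (e, c e)).2))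
  simpa [charge] using h

theorem not_isomorphic_cfi_singleton (hk : 2 ≤ k) (hcard : ∀ v, (edgesAt G v).card = k)
    (hG : G.IsBipartite) (v : V) : ¬ (cfi G k ∅).Isomorphic (cfi G k {v}) := by
  classical
  intro h
  obtain ⟨π, hπ⟩ := exists_fiberwise_of_isomorphic hk hcard h
  have charge_sum (s : Finset V) : ∑ u ∈ s, charge {v} u = if v ∈ s then 1 else 0 := by
    simp [charge, Set.indicator_apply, Finset.sum_ite_eq']
  obtain ⟨S, T, hST⟩ := SimpleGraph.IsBipartite.exists_isBipartiteWith hG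
  have hst : G.IsBipartiteWith (S.toFinset : Set V) (T.toFinset : Set V) := by simpa using hST
  have hsum := two_mul_sum_charge_eq hk hcard hst hπ
  obtain ⟨e, he⟩ := Finset.card_pos.1 ((two_pos.trans_le hk).trans_eq (hcard v).symm)
  obtain ⟨w, -, hvw⟩ := exists_ne_and_edge_eq he
  have hvw : G.Adj v w := G.mem_edgeSet.1 (hvw ▸ e.2)
  rw [charge_sum, charge_sum] at hsum
  rcases hST.mem_of_adj hvw with ⟨hv, -⟩ | ⟨hv, -⟩
  · have hv' : v ∉ T := Set.disjoint_left.1 hST.disjoint hv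
    simp only [Set.mem_toFinset, hv, hv', if_true, if_false] at hsum
    exact absurd hsum (by decide)
  · have hv' : v ∉ S := Set.disjoint_right.1 hST.disjoint hv
    simp only [Set.mem_toFinset, hv, hv', if_true, if_false] at hsum
    exact absurd hsum (by decide)

end NotIsomorphic

section Transfer

variable {V W : Type*} {G : SimpleGraph V} {H : SimpleGraph W}

theorem isRegularOfDegree_of_iso [G.LocallyFinite] [H.LocallyFinite] {d : ℕ} (φ : G ≃g H)
    (hH : H.IsRegularOfDegree d) : G.IsRegularOfDegree d :=
  fun v => (φ.degree_eq v).symm.trans (hH (φ v))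

theorem preconnected_induce_of_iso (φ : G ≃g H) (hH : ∀ w, (H.induce {w}ᶜ).Preconnected) (v : V) :
    (G.induce {v}ᶜ).Preconnected :=
  (φ.induce (φ.toEquiv.bijOn fun _ => not_congr φ.injective.eq_iff)).preconnected_iff.2 (hH (φ v))

end Transfer

section Biclique

variable {n : ℕ}

theorem bicliqueMinusMatching_adj {x y : Fin n ⊕ Fin n} :
    (bicliqueMinusMatching n).Adj x y ↔
      x.isLeft ≠ y.isLeft ∧ Sum.elim id id x ≠ Sum.elim id id y := by
  rcases x with i | i <;> rcases y with j | j <;>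
    simp [bicliqueMinusMatching, eq_comm]

theorem isBipartite_bicliqueMinusMatching : (bicliqueMinusMatching n).IsBipartite :=
  (SimpleGraph.Coloring.mk Sum.isLeft fun h => (bicliqueMinusMatching_adj.1 h).1).colorable

theorem isRegularOfDegree_bicliqueMinusMatching [(bicliqueMinusMatching (n + 1)).LocallyFinite] :
    (bicliqueMinusMatching (n + 1)).IsRegularOfDegree n := by
  intro v
  have hadj : (bicliqueMinusMatching (n + 1)).neighborFinset v =
      (Finset.univ.erase (Sum.elim id id v)).map
        (if v.isLeft then Function.Embedding.inr else Function.Embedding.inl) := by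
    ext w
    rcases v with i | i <;> rcases w with j | j <;> simp [bicliqueMinusMatching_adj, eq_comm]
  simp [← SimpleGraph.card_neighborFinset_eq_degree, hadj]

theorem preconnected_induce_bicliqueMinusMatching (hn : 3 ≤ n) (v : Fin n ⊕ Fin n) :
    ((bicliqueMinusMatching n).induce {v}ᶜ).Preconnected := by
  have hswap : v.swap ∈ ({v}ᶜ : Set (Fin n ⊕ Fin n)) := by rcases v with i | i <;> simp
  have hhub {w : Fin n ⊕ Fin n} (hwv : w ≠ v) (hw : w.isLeft = v.isLeft) :
      (bicliqueMinusMatching n).Adj w v.swap := by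
    rcases v with i | i <;> rcases w with j | j <;> simp_all [bicliqueMinusMatching_adj]
  have hreach (w : ({v}ᶜ : Set (Fin n ⊕ Fin n))) :
      ((bicliqueMinusMatching n).induce {v}ᶜ).Reachable w ⟨v.swap, hswap⟩ := by
    by_cases hw : w.1.isLeft = v.isLeft
    · have hadj : ((bicliqueMinusMatching n).induce {v}ᶜ).Adj w ⟨v.swap, hswap⟩ := hhub w.2 hw
      exact hadj.reachable
    · obtain ⟨m, hmv, hmw⟩ :=
        Fin.exists_ne_and_ne_of_two_lt (Sum.elim id id v) (Sum.elim id id w.1) hn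
      obtain ⟨x, hx, rfl⟩ : ∃ x : Fin n ⊕ Fin n, x.isLeft = v.isLeft ∧ Sum.elim id id x = m := by
        rcases v with i | i
        exacts [⟨.inl m, rfl, rfl⟩, ⟨.inr m, rfl, rfl⟩]
      have hxv : x ≠ v := fun h => hmv (congrArg _ h)
      have hwx : ((bicliqueMinusMatching n).induce {v}ᶜ).Adj w ⟨x, hxv⟩ :=
        bicliqueMinusMatching_adj.2 ⟨hx ▸ hw, hmw.symm⟩
      have hxhub : ((bicliqueMinusMatching n).induce {v}ᶜ).Adj ⟨x, hxv⟩ ⟨v.swap, hswap⟩ :=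
        hhub hxv hx
      exact hwx.reachable.trans hxhub.reachable
  exact fun u w => (hreach u).trans (hreach w).symm

theorem nonempty_edgeSet_bicliqueMinusMatching (hn : 2 ≤ n) :
    Nonempty (bicliqueMinusMatching n).edgeSet := by
  have : Nontrivial (Fin n) := Fin.nontrivial_iff_two_le.2 hn
  obtain ⟨i, j, hij⟩ := exists_pair_ne (Fin n)
  exact ⟨s(.inl i, .inr j), bicliqueMinusMatching_adj.2 ⟨by simp, hij⟩⟩

end Biclique

section Separation

theorem ar_cfiVocabulary_le {k : ℕ} (hk : 2 ≤ k) (i : Fin (cfiVocabulary k).m) :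
    (cfiVocabulary k).ar i ≤ k := by
  fin_cases i
  exacts [le_rfl, le_rfl, hk]

variable {V : Type} [Fintype V] [LinearOrder V] {G : SimpleGraph V} [Nonempty G.edgeSet] {k : ℕ}

theorem exists_cfiTwisted_eq : ∃ v, cfiTwisted G k = cfi G k {v} := by
  obtain ⟨e⟩ := ‹Nonempty G.edgeSet›
  have : Nonempty V := ⟨(e : Sym2 V).inf⟩
  obtain ⟨v, hv⟩ := Finite.exists_min (id : V → V)
  exact ⟨v, congrArg (cfi G k) (Set.ext fun w =>
    ⟨fun hw => le_antisymm (hw v) (hv w), fun hw => hw.symm ▸ hv⟩)⟩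

theorem not_isomorphic_cfiTwisted (hk : 2 ≤ k) (hcard : ∀ v, (edgesAt G v).card = k)
    (hG : G.IsBipartite) : ¬ (cfiUntwisted G k).Isomorphic (cfiTwisted G k) := by
  obtain ⟨v, hv⟩ := exists_cfiTwisted_eq (G := G) (k := k)
  exact hv ▸ not_isomorphic_cfi_singleton hk hcard hG v

theorem exists_uniformStrategy_cfiTwisted (hk : 3 ≤ k) (hcard : ∀ v, (edgesAt G v).card = k)
    (hG : ∀ v, (G.induce {v}ᶜ).Preconnected) :
    ∃ W, IsUniformStrategy (k := k) (cfiUntwisted G k) (cfiTwisted G k) W ∧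
      W (fun _ => none) (fun _ => none) := by
  obtain ⟨v, hv⟩ := exists_cfiTwisted_eq (G := G) (k := k)
  rw [hv]
  refine ⟨_, isUniformStrategy_isShearPosition hk hcard hG ∅ {v}, isShearPosition_empty (v := v)
    (Finset.card_pos.1 (by rw [hcard]; positivity)) fun u hu => ?_⟩
  simp [charge, hu]

theorem models_iff_cfiTwisted (hk : 3 ≤ k) (hcard : ∀ v, (edgesAt G v).card = k)
    (hG : ∀ v, (G.induce {v}ᶜ).Preconnected)
    (φ : Sentence (cfiVocabulary k) k (maltsevQuantifiersOfArity k)) :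
    (cfiUntwisted G k).Models φ ↔ (cfiTwisted G k).Models φ := by
  obtain ⟨W, hW, hempty⟩ := exists_uniformStrategy_cfiTwisted hk hcard hG
  exact hW.models_iff (fun _ hQ => hQ.1) hempty φ

end Separation

theorem logicLT_maltsevQuantifiersOfArity {k : ℕ} (hk : 3 ≤ k) :
    LogicLT k (maltsevQuantifiersOfArity k) (quantifiersOfArity k) := by
  classical
  have hk' : 2 ≤ k := Nat.le_of_succ_le hk
  let _ : LinearOrder (Fin (k + 1) ⊕ Fin (k + 1)) := LinearOrder.lift' toLex toLex.injective
  have : Nonempty (bicliqueMinusMatching (k + 1)).edgeSet :=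
    nonempty_edgeSet_bicliqueMinusMatching (Nat.le_succ_of_le hk')
  have hcard (v) : (edgesAt (bicliqueMinusMatching (k + 1)) v).card = k :=
    (card_edgesAt v).trans (isRegularOfDegree_bicliqueMinusMatching v)
  obtain ⟨φ, hφ, hφ'⟩ := exists_sentence_of_not_isomorphic (ar_cfiVocabulary_le hk')
    (not_isomorphic_cfiTwisted hk' hcard isBipartite_bicliqueMinusMatching)
  exact .of_subset Set.inter_subset_right φ hφ hφ' (models_iff_cfiTwisted hk hcard
    (preconnected_induce_bicliqueMinusMatching (Nat.le_succ_of_le hk)))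

theorem mainTheorem4_general (k : ℕ) (hk : 3 ≤ k) :
    LogicLT k (maltsevQuantifiersOfArity k) (quantifiersOfArity k) ∧
    ∀ (V : Type) [Fintype V] [LinearOrder V] (G : SimpleGraph V) [G.LocallyFinite]
      [Nonempty G.edgeSet],
      G.IsRegularOfDegree k → G.IsBipartite → (∀ v, (G.induce {v}ᶜ).Preconnected) →
        ¬ (cfiUntwisted G k).Isomorphic (cfiTwisted G k) ∧
        (∃ φ : Sentence (cfiVocabulary k) k (quantifiersOfArity k),
          (cfiUntwisted G k).Models φ ∧ ¬ (cfiTwisted G k).Models φ) ∧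
        (∀ φ : Sentence (cfiVocabulary k) k (maltsevQuantifiersOfArity k),
          (cfiUntwisted G k).Models φ ↔ (cfiTwisted G k).Models φ) ∧
        DuplicatorWins k (cfiUntwisted G k) (cfiTwisted G k) (fun _ => none) (fun _ => none) := by
  refine ⟨logicLT_maltsevQuantifiersOfArity hk, fun V _ _ G _ _ hreg hbip hconn => ?_⟩
  have hk' : 2 ≤ k := Nat.le_of_succ_le hk
  have hcard (v : V) : (edgesAt G v).card = k := (card_edgesAt v).trans (hreg v)
  have hiso := not_isomorphic_cfiTwisted hk' hcard hbip
  obtain ⟨W, hW, hempty⟩ := exists_uniformStrategy_cfiTwisted hk hcard hconn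
  exact ⟨hiso, exists_sentence_of_not_isomorphic (ar_cfiVocabulary_le hk') hiso,
    models_iff_cfiTwisted hk hcard hconn, hW.duplicatorWins hempty⟩

theorem mainTheorem4 (k : ℕ) (hk : 3 ≤ k) :
    LogicLT k (maltsevQuantifiersOfArity k) (quantifiersOfArity k) ∧
    ∀ (V : Type) [Fintype V] [LinearOrder V] (G : SimpleGraph V) [Nonempty G.edgeSet],
      Nonempty (G ≃g bicliqueMinusMatching (k + 1)) →
        ¬ (cfiUntwisted G k).Isomorphic (cfiTwisted G k) ∧
        (∃ φ : Sentence (cfiVocabulary k) k (quantifiersOfArity k),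
          (cfiUntwisted G k).Models φ ∧ ¬ (cfiTwisted G k).Models φ) ∧
        (∀ φ : Sentence (cfiVocabulary k) k (maltsevQuantifiersOfArity k),
          (cfiUntwisted G k).Models φ ↔ (cfiTwisted G k).Models φ) ∧
        DuplicatorWins k (cfiUntwisted G k) (cfiTwisted G k) (fun _ => none) (fun _ => none) := by
  classical
  exact ⟨(mainTheorem4_general k hk).1, fun V _ _ G _ ⟨φ⟩ => (mainTheorem4_general k hk).2 V G
    (isRegularOfDegree_of_iso φ isRegularOfDegree_bicliqueMinusMatching)
    (isBipartite_bicliqueMinusMatching.of_hom φ.toHom)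
    (preconnected_induce_of_iso φ (preconnected_induce_bicliqueMinusMatching (by lia)))⟩
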